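/- Let $\beta_c=\log 4$ and $K(\beta)=(e^\beta+2)/(4\beta)$ for $\beta>0$, so that $(\beta_c,K(\beta_c))$ is the tricritical point of the mean-field Blume–Capel (Blume–Emery–Griffiths) model. For $\beta,K>0$ let $$\rho=\tfrac13(\delta_{-1}+\delta_0+\delta_1),\qquad \rho_\beta(d\omega)=\frac{e^{-\beta\omega^2}\rho(d\omega)}{\int e^{-\beta\omega^2}\rho(d\omega)},\qquad c_\beta(t)=\log\int e^{t\omega}\,\rho_\beta(d\omega)=\log\frac{1+e^{-\beta}(e^t+e^{-t})}{1+2e^{-\beta}},$$ let $G_{\beta,K}(x)=\beta Kx^2-c_\beta(2\beta Kx)$ $(x\in\mathbb R)$ be the free-energy functional, let $J_\beta(x)=\sup_{t\in\mathbb R}\{tx-c_\beta(t)\}$, and let $$I_{\beta,K}(x)=J_\beta(x)-\beta Kx^2-\inf_{y\in[-1,1]}\{J_\beta(y)-\beta Ky^2\},\qquad \mathcal M_{\beta,K}=\{x\in[-1,1]: I_{\beta,K}(x)=0\}$$ be the rate function of the spin per site and the set of equilibrium macrostates. Let $m(\beta,K)=\sup\mathcal M_{\beta,K}$ be the magnetization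 (so $m(\beta,K)=m$ whenever $\mathcal M_{\beta,K}=\{m,-m\}$ with $m>0$). **Theorem.** Let $\alpha>0$ and $\ell\in\mathbb R$, and for $n \in \mathbb N$ define $$\beta_n=\beta_c-\frac1{n^{\alpha}},\qquad K_n=K(\beta_c)-\frac{K'(\beta_c)}{n^{\alpha}}+\frac{\ell}{2n^{2\alpha}}.$$ Then $(\beta_n,K_n)\to(\beta_c,K(\beta_c))$ as $n\to\infty$, and the following hold. (a) With $u=1-3\alpha$ and $\gamma=\alpha/2$, $$n^{1-u}\,G_{\beta_n,K_n}(x/n^{\gamma})\;\longrightarrow\; g(x)=\tfrac12\beta_c\,(K''(\beta_c)-\ell)\,x^2+\tfrac34x^4+\tfrac9{40}x^6$$ uniformly for $x$ in compact subsets of $\mathbb R$. (b) The polynomial $g$ has a nonzero global minimum point if and only if $\ell>K''(\beta_c)$. If this inequality holds, then the set of global minimum points of $g$ is $\{\bar x,-\bar x\}$, where $$\bar x=\frac{\sqrt{10}}{3}\left(-1+\Bigl(1+\tfrac{3\beta_c}{5}\,(\ell-K''(\beta_c))\Bigr)^{1/2}\right)^{1/2}.$$ (c) Assume that $\ell>K''(\beta_c)$.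 Then, for all sufficiently large $n$, $m(\beta_n,K_n)>0$ and $\mathcal M_{\beta_n,K_n}=\{m(\beta_n,K_n),-m(\beta_n,K_n)\}$. Moreover $m(\beta_n,K_n)\to0$, and $$m(\beta_n,K_n)\sim\frac{\bar x}{n^{\alpha/2}}=\bar x\,(\beta_c-\beta_n)^{1/2},\qquad\text{i.e.}\qquad \lim_{n\to\infty}n^{\alpha/2}\,m(\beta_n,K_n)=\bar x .$$ -/

import Mathlib

open MeasureTheory Filter Topology Asymptotics

noncomputable section

namespace BlumeCapel

/-- The uniform distribution `(1/3) (δ₋₁ + δ₀ + δ₁)` of a single spin with values in `{-1, 0, 1}`. -/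
def spinMeasure : Measure ℝ :=
  (3 : ENNReal)⁻¹ • (Measure.dirac (-1) + Measure.dirac 0 + Measure.dirac 1)

/-- The tilted single-spin law `ρ_β(dω) = exp (-β ω²) ρ(dω) / Z(β)`. -/
def tiltedSpin (β : ℝ) : Measure ℝ :=
  spinMeasure.tilted (fun ω => -β * ω ^ 2)

/-- The cumulant generating function `c_β(t) = log ∫ exp (t ω) ρ_β(dω)`. -/
def cumulant (β t : ℝ) : ℝ :=
  ProbabilityTheory.cgf id (tiltedSpin β) t

/-- The closed form of the cumulant generating function. -/
theorem cumulant_eq (β t : ℝ) :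
    cumulant β t = Real.log
      ((1 + Real.exp (-β) * (Real.exp t + Real.exp (-t))) / (1 + 2 * Real.exp (-β))) := by
  have key : ∀ f : ℝ → ℝ,
      ∫ x, f x ∂spinMeasure = 3⁻¹ * (f (-1) + f 0 + f 1) := by
    intro f
    unfold spinMeasure
    have hi : ∀ a : ℝ, Integrable f (Measure.dirac a) := fun a =>
      integrable_dirac (by simp)
    rw [integral_smul_measure,
      integral_add_measure ((hi _).add_measure (hi _)) (hi _),
      integral_add_measure (hi _) (hi _)]
    simp
  unfold cumulant ProbabilityTheory.cgf ProbabilityTheory.mgf tiltedSpin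
  rw [integral_tilted, key, key]
  congr 1
  simp
  field_simp
  ring

/-- The Legendre-Fenchel transform `J_β(x) = sup_t (t x - c_β(t))`; the supremum is finite
for `x ∈ [-1, 1]`, the only arguments at which it is used. -/
def cramerRate (β x : ℝ) : ℝ :=
  ⨆ t : ℝ, (t * x - cumulant β t)

/-- The large deviation rate function
`I_{β,K}(x) = J_β(x) - β K x² - inf_{y ∈ [-1,1]} (J_β(y) - β K y²)` on `[-1, 1]`. -/
def rateFunction (β K x : ℝ) : ℝ :=
  cramerRate β x - β * K * x ^ 2
    - ⨅ y : Set.Icc (-1 : ℝ) 1, (cramerRate β y - β * K * (y : ℝ) ^ 2)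

/-- The set `M_{β,K}` of equilibrium macrostates: the zeros of the rate function in `[-1, 1]`. -/
def equilibria (β K : ℝ) : Set ℝ :=
  {x | x ∈ Set.Icc (-1 : ℝ) 1 ∧ rateFunction β K x = 0}

/-- The spontaneous magnetization `m(β,K)`: the largest equilibrium macrostate. When
`M_{β,K} = {m, -m}` with `m > 0`, this is `m`. -/
def magnetization (β K : ℝ) : ℝ :=
  sSup (equilibria β K)

/-- The free-energy functional `G_{β,K}(x) = β K x² - c_β(2 β K x)`. -/
def freeEnergy (β K x : ℝ) : ℝ :=
  β * K * x ^ 2 - cumulant β (2 * β * K * x)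

/-- The curve `K(β) = (e^β + 2) / (4 β)`. -/
def critCurve (β : ℝ) : ℝ :=
  (Real.exp β + 2) / (4 * β)

/-- The critical inverse temperature `β_c = log 4`. -/
def betaC : ℝ :=
  Real.log 4

/-- The sequence `β_n = β_c - 1 / n^α`. -/
def betaSeq (α : ℝ) (n : ℕ) : ℝ :=
  betaC - 1 / (n : ℝ) ^ α

/-- The sequence `K_n = K(β_c) - K'(β_c) / n^α + ℓ / (2 n^{2α})`. -/
def kSeq (α ℓ : ℝ) (n : ℕ) : ℝ :=
  critCurve betaC - deriv critCurve betaC / (n : ℝ) ^ α + ℓ / (2 * (n : ℝ) ^ (2 * α))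

/-- The Ginzburg-Landau polynomial
`g(x) = (1/2) β_c (K''(β_c) - ℓ) x² + 4 c₄ x⁴ + c₆ x⁶` with `c₄ = 3/16` and `c₆ = 9/40`. -/
def glPoly (ℓ x : ℝ) : ℝ :=
  1 / 2 * betaC * (iteratedDeriv 2 critCurve betaC - ℓ) * x ^ 2
    + 4 * (3 / 16) * x ^ 4 + 9 / 40 * x ^ 6

/-- `x̄ = (√10 / 3) (-1 + (1 + (3 β_c / 5) (ℓ - K''(β_c)))^{1/2})^{1/2}`. -/
def xBar (ℓ : ℝ) : ℝ :=
  Real.sqrt 10 / 3 *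
    Real.sqrt (-1 + Real.sqrt (1 + 3 * betaC / 5 * (ℓ - iteratedDeriv 2 critCurve betaC)))

end BlumeCapel

end

/-! Put `h = 1 / n ^ α`, `b = β K` and `p = spinWeight β`, so that the free energy is `b x² - log (1
+ p (cosh (2 b x) - 1))`, and expand at `x = s √h`. The coefficient of `s²` is of size `h * (1 - 2 b
p)`, and `1 - 2 b p = O(h²)` because the path is tangent to the curve `critCurve`, on which `2 b p =
1`; the coefficient of `s⁴` is of size `h² * (3 p - 1)`, and `3 p - 1 = O(h)`; the sixth-order term
does not degenerate. All three are thus of order `h³` (`tendsto_scaled_freeEnergy_aux`), and the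
limit is joint in `h` and `s`, hence locally uniform.

By Legendre duality the equilibria are the global minimizers of the free energy (`equilibria_eq`).
When `2 β K ≤ 3`, the derivative on the positive axis has the sign of an increasing function, so a
positive minimizer makes the free energy unimodal there (`phase_coexistence`). Unimodality then
locates the magnetization by comparing the values at two points, which the pointwise limit provides.
-/

namespace BlumeCapel

/-! ### Sixth-order expansion of the free energy -/

/-- The probability `2 / (e^β + 2)` that a spin distributed according to `ρ_β` is nonzero. -/
noncomputable def spinWeight (β : ℝ) : ℝ := 2 / (Real.exp β + 2)

theorem spinWeight_pos (β : ℝ) : 0 < spinWeight β := by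
  unfold spinWeight; positivity

theorem spinWeight_lt_one (β : ℝ) : spinWeight β < 1 := by
  unfold spinWeight
  rw [div_lt_one (by positivity)]
  linarith [Real.exp_pos β]

theorem cumulant_eq_log_cosh (β t : ℝ) :
    cumulant β t = Real.log (1 + spinWeight β * (Real.cosh t - 1)) := by
  rw [cumulant_eq, Real.cosh_eq, spinWeight, Real.exp_neg β]
  congr 1
  have := Real.exp_pos β
  field_simp
  ring

/-- Averaging the exponential bounds at `t` and `-t` cancels the odd terms and leaves an error `O(t
^ 8)`. -/
theorem tendsto_cosh_remainder :
    Tendsto (fun t : ℝ => (Real.cosh t - 1 - t ^ 2 / 2 - t ^ 4 / 24 - t ^ 6 / 720) / t ^ 6)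
      (𝓝 0) (𝓝 0) := by
  have hsq : Tendsto (fun t : ℝ => t ^ 2) (𝓝 0) (𝓝 0) := by
    simpa using (continuous_pow 2).tendsto (0 : ℝ)
  refine squeeze_zero_norm' ?_ hsq
  filter_upwards [Metric.ball_mem_nhds (0 : ℝ) one_pos] with t ht
  have ht1 : |t| ≤ 1 := by simpa using (Metric.mem_ball.1 ht).le
  have h1 := Real.exp_bound ht1 (n := 8) (by norm_num)
  have h2 := Real.exp_bound (x := -t) (by simpa using ht1) (n := 8) (by norm_num)
  simp only [Finset.sum_range_succ, Finset.sum_range_zero, Nat.factorial, abs_neg] at h1 h2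
  have e8 : |t| ^ 8 = t ^ 2 * t ^ 6 := by
    rw [← abs_pow, abs_of_nonneg (by positivity)]; ring
  rw [e8] at h1 h2
  have h6 : 0 ≤ t ^ 6 := by positivity
  have h8 : 0 ≤ t ^ 2 * t ^ 6 := by positivity
  rw [Real.norm_eq_abs, abs_div, abs_of_nonneg h6]
  refine div_le_of_le_mul₀ h6 (by positivity) ?_
  rw [abs_le] at h1 h2 ⊢
  norm_num at h1 h2
  rw [Real.cosh_eq]
  ring_nf at h1 h2 h8 ⊢
  constructor <;> linarith [h1.1, h1.2, h2.1, h2.2]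

theorem tendsto_log_remainder :
    Tendsto (fun u : ℝ => (Real.log (1 + u) - u + u ^ 2 / 2 - u ^ 3 / 3) / u ^ 3)
      (𝓝 0) (𝓝 0) := by
  have hsq : Tendsto (fun u : ℝ => 2 * |u|) (𝓝 0) (𝓝 0) := by
    simpa using (continuous_abs.tendsto (0 : ℝ)).const_mul 2
  refine squeeze_zero_norm' ?_ hsq
  filter_upwards [Metric.ball_mem_nhds (0 : ℝ) (one_half_pos)] with u hu
  have hu1 : |u| < 1 / 2 := by simpa using Metric.mem_ball.1 hu
  have h1 := Real.abs_log_sub_add_sum_range_le (x := -u) (by rw [abs_neg]; linarith) 3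
  simp only [Finset.sum_range_succ, Finset.sum_range_zero, abs_neg, sub_neg_eq_add] at h1
  have h3 : 0 ≤ |u| ^ 3 := by positivity
  rw [Real.norm_eq_abs, abs_div, abs_pow]
  refine div_le_of_le_mul₀ h3 (by positivity) ?_
  have e : |u| ^ (3 + 1) / (1 - |u|) ≤ 2 * |u| * |u| ^ 3 := by
    rw [div_le_iff₀ (by linarith)]
    have h4 : 0 ≤ |u| ^ 4 := by positivity
    have h5 := mul_le_mul_of_nonneg_left hu1.le h4
    ring_nf at h5 ⊢
    linarith
  refine le_trans (le_of_eq ?_) (h1.trans e)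
  congr 1
  norm_num
  ring

/-- Here `τ * h` is the square of the argument `t` of `cosh`, `u = p (cosh t - 1)`, and `k` and `r`
carry the Taylor remainders of `cosh` and `log`. Naming the small quotients `A` and `B` lets the
division by `h ^ 3` be carried out algebraically, leaving only terms with limits. -/
theorem expansion_identity {A B b h k p r s u v w τ : ℝ} (hA : A * h ^ 2 = 1 - 2 * b * p)
    (hB : B * h = 3 * p - 1) (hτ : τ = 4 * b ^ 2 * s ^ 2)
    (hw : w = τ ^ 2 / 24 + τ ^ 3 * h * k) (hv : v = τ / 2 + h * w) (hu : u = p * h * v) :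
    (b * A * s ^ 2 + p * τ ^ 2 / 24 * B - p * τ ^ 3 * k + p ^ 2 / 2 * (τ * w + h * w ^ 2)
      - p ^ 3 * v ^ 3 / 3 - p ^ 3 * v ^ 3 * r) * h ^ 3 =
    b * (s ^ 2 * h) - (u - u ^ 2 / 2 + u ^ 3 / 3 + u ^ 3 * r) := by
  have e1 : u ^ 3 = p ^ 3 * v ^ 3 * h ^ 3 := by rw [hu]; ring
  have e2 : u = p * h * (τ / 2 + h * τ ^ 2 / 24 + h ^ 2 * τ ^ 3 * k) := by rw [hu, hv, hw]; ring
  have e3 : u ^ 2 = p ^ 2 * h ^ 2 * (τ ^ 2 / 4 + h * (τ * w + h * w ^ 2)) := by rw [hu, hv]; ring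
  rw [e1, e3]
  have e4 : b * A * s ^ 2 * h ^ 3 = b * s ^ 2 * h - p * h * τ / 2 := by
    rw [hτ]; linear_combination b * s ^ 2 * h * hA
  linear_combination e4 + p * τ ^ 2 / 24 * h ^ 2 * hB + e2

/-- The scaling limit of the free-energy functional near the tricritical point, in terms of
`b = β K` and the weight `p` of the nonzero spins. -/
theorem tendsto_scaled_freeEnergy_aux {ι : Type*} {l : Filter ι} {h s b p : ι → ℝ} {a x : ℝ}
    (h0 : Tendsto h l (𝓝 0)) (hpos : ∀ᶠ i in l, 0 < h i) (hs : Tendsto s l (𝓝 x))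
    (hb : Tendsto b l (𝓝 (3 / 2))) (hp : Tendsto p l (𝓝 (1 / 3)))
    (h2 : Tendsto (fun i => (1 - 2 * b i * p i) / h i ^ 2) l (𝓝 a))
    (h4 : Tendsto (fun i => (3 * p i - 1) / h i) l (𝓝 (2 / 3))) :
    Tendsto (fun i => (b i * (s i * √(h i)) ^ 2
        - Real.log (1 + p i * (Real.cosh (2 * b i * (s i * √(h i))) - 1))) / h i ^ 3) l
      (𝓝 (3 / 2 * a * x ^ 2 + 3 / 4 * x ^ 4 + 9 / 40 * x ^ 6)) := by
  have hsqrt : Tendsto (fun i => √(h i)) l (𝓝 0) := by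
    simpa using h0.sqrt
  set M : ℝ → ℝ := fun t => (Real.cosh t - 1 - t ^ 2 / 2 - t ^ 4 / 24 - t ^ 6 / 720) / t ^ 6
    with hM
  set L : ℝ → ℝ := fun u => (Real.log (1 + u) - u + u ^ 2 / 2 - u ^ 3 / 3) / u ^ 3 with hL
  -- Since `x / 0 = 0`, both expansions hold at the origin too; this matters because `s` may vanish.
  have hMeq : ∀ t, Real.cosh t - 1 = t ^ 2 / 2 + t ^ 4 / 24 + t ^ 6 / 720 + t ^ 6 * M t := by
    intro t
    by_cases ht : t = 0
    · simp [ht]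
    · simp only [hM]; field_simp; ring
  have hLeq : ∀ u, Real.log (1 + u) = u - u ^ 2 / 2 + u ^ 3 / 3 + u ^ 3 * L u := by
    intro u
    by_cases hu : u = 0
    · simp [hu]
    · simp only [hL]; field_simp; ring
  set t : ι → ℝ := fun i => 2 * b i * (s i * √(h i)) with ht
  have ht0 : Tendsto t l (𝓝 0) := by
    simpa using (hb.const_mul 2).mul (hs.mul hsqrt)
  set m : ι → ℝ := fun i => M (t i) with hm
  have hm0 : Tendsto m l (𝓝 0) := tendsto_cosh_remainder.comp ht0
  set τ : ι → ℝ := fun i => 4 * b i ^ 2 * s i ^ 2 with hτ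
  have hτl : Tendsto τ l (𝓝 (4 * (3 / 2) ^ 2 * x ^ 2)) :=
    ((hb.pow 2).const_mul 4).mul (hs.pow 2)
  set w : ι → ℝ := fun i => τ i ^ 2 / 24 + τ i ^ 3 * h i * (1 / 720 + m i) with hw
  have hwl : Tendsto w l (𝓝 ((4 * (3 / 2) ^ 2 * x ^ 2) ^ 2 / 24 +
      (4 * (3 / 2) ^ 2 * x ^ 2) ^ 3 * 0 * (1 / 720 + 0))) :=
    ((hτl.pow 2).div_const 24).add (((hτl.pow 3).mul h0).mul (hm0.const_add _))
  set v : ι → ℝ := fun i => τ i / 2 + h i * w i with hv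
  have hvl := ((hτl.div_const 2).add (h0.mul hwl) : Tendsto v l _)
  set u : ι → ℝ := fun i => p i * h i * v i with hu
  have hu0 : Tendsto u l (𝓝 0) := by
    simpa using (hp.mul h0).mul hvl
  set r : ι → ℝ := fun i => L (u i) with hr
  have hr0 : Tendsto r l (𝓝 0) := tendsto_log_remainder.comp hu0
  have key : ∀ᶠ i in l, b i * ((1 - 2 * b i * p i) / h i ^ 2) * s i ^ 2
      + p i * τ i ^ 2 / 24 * ((3 * p i - 1) / h i) - p i * τ i ^ 3 * (1 / 720 + m i)
      + p i ^ 2 / 2 * (τ i * w i + h i * w i ^ 2) - p i ^ 3 * v i ^ 3 / 3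
      - p i ^ 3 * v i ^ 3 * r i =
      (b i * (s i * √(h i)) ^ 2
        - Real.log (1 + p i * (Real.cosh (2 * b i * (s i * √(h i))) - 1))) / h i ^ 3 := by
    filter_upwards [hpos] with i hi
    have hsq : √(h i) ^ 2 = h i := Real.sq_sqrt hi.le
    have e1 : p i * (Real.cosh (2 * b i * (s i * √(h i))) - 1) = u i := by
      rw [hMeq]
      change p i * (t i ^ 2 / 2 + t i ^ 4 / 24 + t i ^ 6 / 720 + t i ^ 6 * m i) = u i
      have e2 : t i ^ 2 = τ i * h i := by
        simp only [ht, hτ]; rw [mul_pow, mul_pow, mul_pow, hsq]; ring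
      have e4 : t i ^ 4 = (τ i * h i) ^ 2 := by rw [← e2]; ring
      have e6 : t i ^ 6 = (τ i * h i) ^ 3 := by rw [← e2]; ring
      rw [e2, e4, e6]
      simp only [hu, hv, hw]
      ring
    rw [e1, hLeq, mul_pow (s i), hsq]
    change _ = (_ - (u i - u i ^ 2 / 2 + u i ^ 3 / 3 + u i ^ 3 * r i)) / _
    rw [eq_div_iff (by positivity)]
    exact expansion_identity (by field_simp) (by field_simp) rfl rfl rfl rfl
  -- At the limit `τ = 9 x²` and `p = 1/3`; the sextic coefficient is `729 * (-1/2160 + 1/432 -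
  -- 1/648) = 9/40`.
  have lim := (((((hb.mul h2).mul (hs.pow 2)).add
    (((hp.mul (hτl.pow 2)).div_const 24).mul h4)).sub
    ((hp.mul (hτl.pow 3)).mul (hm0.const_add (1 / 720)))).add
    (((hp.pow 2).div_const 2).mul ((hτl.mul hwl).add (h0.mul (hwl.pow 2))))).sub
    (((hp.pow 3).mul (hvl.pow 3)).div_const 3) |>.sub
    (((hp.pow 3).mul (hvl.pow 3)).mul hr0)
  refine (Tendsto.congr' key lim).trans (le_of_eq ?_)
  congr 1
  ring

/-! ### Coefficients along the path to the tricritical point -/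

theorem exp_betaC : Real.exp betaC = 4 := Real.exp_log (by norm_num)

theorem betaC_pos : 0 < betaC := Real.log_pos (by norm_num)

theorem critCurve_betaC : critCurve betaC = 3 / (2 * betaC) := by
  have := betaC_pos
  rw [critCurve, exp_betaC]
  field_simp
  norm_num

theorem contDiffOn_critCurve : ContDiffOn ℝ 2 critCurve (Set.Ioi 0) := by
  unfold critCurve
  refine ContDiffOn.div (by fun_prop) (by fun_prop) fun x hx => ?_
  have : (0 : ℝ) < x := hx
  positivity

/-- The left side is the derivative of `β * critCurve β = (e^β + 2) / 4`, which is `e^β / 4`. -/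
theorem deriv_critCurve_betaC :
    critCurve betaC + betaC * deriv critCurve betaC = 1 := by
  have hpos := betaC_pos
  have h : HasDerivAt critCurve ((Real.exp betaC * (4 * betaC) - (Real.exp betaC + 2) * 4) /
      (4 * betaC) ^ 2) betaC := by
    refine ((Real.hasDerivAt_exp betaC).add_const 2).div ?_ (by positivity)
    simpa using (hasDerivAt_id betaC).const_mul 4
  rw [h.deriv, critCurve, exp_betaC]
  field_simp
  ring

theorem tendsto_taylor_two {f : ℝ → ℝ} {s : Set ℝ} (hs : Convex ℝ s) (ho : IsOpen s) {c : ℝ}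
    (hc : c ∈ s) (hf : ContDiffOn ℝ 2 f s) :
    Tendsto (fun h => (f (c - h) - f c + deriv f c * h) / h ^ 2) (𝓝[>] 0)
      (𝓝 (iteratedDeriv 2 f c / 2)) := by
  have h1 := Real.taylor_tendsto hs hc (n := 2) (by exact_mod_cast hf)
  rw [ho.nhdsWithin_eq hc] at h1
  have h2 : Tendsto (fun h : ℝ => c - h) (𝓝[>] 0) (𝓝 c) := by
    have : Tendsto (fun h : ℝ => c - h) (𝓝 0) (𝓝 (c - 0)) := by
      exact (continuous_const.sub continuous_id).tendsto 0
    rw [sub_zero] at this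
    exact this.mono_left nhdsWithin_le_nhds
  have h3 := (h1.comp h2).add_const (iteratedDeriv 2 f c / 2)
  rw [zero_add] at h3
  refine h3.congr' ?_
  filter_upwards [self_mem_nhdsWithin] with h hh
  have hh' : h ≠ 0 := (show (0 : ℝ) < h from hh).ne'
  simp only [Function.comp, taylorWithinEval_succ, taylor_within_zero_eval,
    iteratedDerivWithin_of_isOpen ho hc, smul_eq_mul]
  norm_num
  field_simp
  ring

theorem tendsto_nhdsGT_of_continuousAt {f : ℝ → ℝ} (hf : ContinuousAt f 0) :
    Tendsto f (𝓝[>] 0) (𝓝 (f 0)) := hf.tendsto.mono_left nhdsWithin_le_nhds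

/-- The path `K(β_c) - K'(β_c) h + ℓ h² / 2` approaching the tricritical point. -/
noncomputable def kPath (ℓ h : ℝ) : ℝ :=
  critCurve betaC - deriv critCurve betaC * h + ℓ / 2 * h ^ 2

theorem tendsto_beta_mul_kPath (ℓ : ℝ) :
    Tendsto (fun h => (betaC - h) * kPath ℓ h) (𝓝[>] 0) (𝓝 (3 / 2)) := by
  have hc := betaC_pos
  have : (3 / 2 : ℝ) = (fun h => (betaC - h) * kPath ℓ h) 0 := by
    simp [kPath, critCurve_betaC]; field_simp
  rw [this]
  apply tendsto_nhdsGT_of_continuousAt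
  unfold kPath
  fun_prop

theorem tendsto_spinWeight : Tendsto (fun h => spinWeight (betaC - h)) (𝓝[>] 0) (𝓝 (1 / 3)) := by
  have : (1 / 3 : ℝ) = (fun h => spinWeight (betaC - h)) 0 := by
    simp [spinWeight, exp_betaC]; norm_num
  rw [this]
  apply tendsto_nhdsGT_of_continuousAt
  unfold spinWeight
  refine ContinuousAt.div (by fun_prop) (by fun_prop) ?_
  positivity

theorem tendsto_quartic_coeff :
    Tendsto (fun h => (3 * spinWeight (betaC - h) - 1) / h) (𝓝[>] 0) (𝓝 (2 / 3)) := by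
  have hd : HasDerivAt (fun h => 3 * spinWeight (betaC - h) - 1) (2 / 3) 0 := by
    unfold spinWeight
    have h1 : HasDerivAt (fun h => Real.exp (betaC - h) + 2) (-4) 0 := by
      have := (((hasDerivAt_id (0 : ℝ)).const_sub betaC).exp).add_const 2
      simpa [exp_betaC] using this
    have h2 := (((hasDerivAt_const (0 : ℝ) (2 : ℝ)).div h1 (by positivity)).const_mul 3).sub_const 1
    refine h2.congr_deriv ?_
    simp only [sub_zero, exp_betaC]
    norm_num
  have h3 := hd.tendsto_slope_zero_right
  refine h3.congr fun h => ?_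
  simp [spinWeight, exp_betaC]
  ring

/-- Since `2 β p = 1 / critCurve β`, the numerator is `(critCurve β - K) / critCurve β`. The path
shares the first-order Taylor polynomial of the curve, so only the second-order difference `(K'' -
ℓ) / 2` survives. -/
theorem tendsto_quadratic_coeff (ℓ : ℝ) :
    Tendsto (fun h => (1 - 2 * ((betaC - h) * kPath ℓ h) * spinWeight (betaC - h)) / h ^ 2)
      (𝓝[>] 0) (𝓝 (betaC / 3 * (iteratedDeriv 2 critCurve betaC - ℓ))) := by
  have hc := betaC_pos
  have h1 := tendsto_taylor_two (convex_Ioi 0) isOpen_Ioi (Set.mem_Ioi.2 hc) contDiffOn_critCurve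
  have h2 : Tendsto (fun h => critCurve (betaC - h)) (𝓝[>] 0) (𝓝 (3 / (2 * betaC))) := by
    have : (3 / (2 * betaC) : ℝ) = (fun h => critCurve (betaC - h)) 0 := by
      simp [critCurve_betaC]
    rw [this]
    apply tendsto_nhdsGT_of_continuousAt
    have h3 := contDiffOn_critCurve.continuousOn.continuousAt (Ioi_mem_nhds hc)
    refine ContinuousAt.comp (g := critCurve) (by simpa using h3) (by fun_prop)
  have h3 := (h1.sub_const (ℓ / 2)).div h2 (by positivity)
  have e : (iteratedDeriv 2 critCurve betaC / 2 - ℓ / 2) / (3 / (2 * betaC)) =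
      betaC / 3 * (iteratedDeriv 2 critCurve betaC - ℓ) := by
    field_simp
  rw [e] at h3
  refine h3.congr' ?_
  filter_upwards [Ioo_mem_nhdsGT hc] with h hh
  have hb : 0 < betaC - h := by linarith [hh.2]
  have hh0 := hh.1.ne'
  have hK : critCurve (betaC - h) ≠ 0 := by
    unfold critCurve; positivity
  have hw : spinWeight (betaC - h) = 1 / (2 * ((betaC - h) * critCurve (betaC - h))) := by
    have := Real.exp_pos (betaC - h)
    unfold spinWeight critCurve; field_simp; norm_num
  simp only [Pi.div_apply]
  rw [hw, kPath]
  field_simp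
  ring

/-- By `deriv_critCurve_betaC`, `2 β K = 3 - h * (2 + O(h))`: the path approaches the bound 3
required for unimodality from below. -/
theorem eventually_beta_mul_kPath_lt (ℓ : ℝ) :
    ∀ᶠ h in 𝓝[>] 0, 2 * ((betaC - h) * kPath ℓ h) < 3 := by
  have hc := betaC_pos
  have h1 : Tendsto (fun h => 2 + (-2 * deriv critCurve betaC - ℓ * betaC) * h + ℓ * h ^ 2)
      (𝓝[>] 0) (𝓝 2) := by
    have h0 := tendsto_nhdsGT_of_continuousAt
      (f := fun h => 2 + (-2 * deriv critCurve betaC - ℓ * betaC) * h + ℓ * h ^ 2) (by fun_prop)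
    simpa using h0
  filter_upwards [h1.eventually_const_lt two_pos, self_mem_nhdsWithin] with h h2 hh
  have hh' : 0 < h := hh
  have h3 := deriv_critCurve_betaC
  have h4 : betaC * critCurve betaC = 3 / 2 := by
    rw [critCurve_betaC]; field_simp
  have h5 := mul_pos hh' h2
  unfold kPath
  set D := deriv critCurve betaC
  set C := critCurve betaC
  nlinarith

/-! ### Equilibria as minimizers of the free energy -/

/-- The partition function `∫ exp (t ω) ρ_β(dω)` in terms of the weight `p` of nonzero spins. -/
noncomputable def spinMgf (p t : ℝ) : ℝ := 1 + p * (Real.cosh t - 1)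

theorem spinMgf_pos {p : ℝ} (h0 : 0 < p) (t : ℝ) : 0 < spinMgf p t := by
  have := mul_nonneg h0.le (sub_nonneg.2 (Real.one_le_cosh t))
  unfold spinMgf
  linarith

/-- The mean spin under the law tilted by `exp (t ω)`. -/
noncomputable def spinMean (p t : ℝ) : ℝ := p * Real.sinh t / spinMgf p t

theorem hasDerivAt_cumulant (β t : ℝ) :
    HasDerivAt (cumulant β) (spinMean (spinWeight β) t) t := by
  have h1 : HasDerivAt (spinMgf (spinWeight β)) (spinWeight β * Real.sinh t) t :=
    (((Real.hasDerivAt_cosh t).sub_const 1).const_mul _).const_add 1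
  have h2 := h1.log (spinMgf_pos (spinWeight_pos β) t).ne'
  exact h2.congr_of_eventuallyEq (.of_forall fun s => cumulant_eq_log_cosh β s)

theorem abs_spinMean_lt_one {p : ℝ} (h0 : 0 < p) (h1 : p < 1) (t : ℝ) : |spinMean p t| < 1 := by
  have hZ := spinMgf_pos h0 t
  have hs : |Real.sinh t| < Real.cosh t := by
    rw [abs_lt, Real.sinh_eq, Real.cosh_eq]
    constructor <;> linarith [Real.exp_pos t, Real.exp_pos (-t)]
  rw [spinMean, abs_div, abs_of_pos hZ, div_lt_one hZ, abs_mul, abs_of_pos h0, spinMgf]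
  nlinarith [mul_lt_mul_of_pos_left hs h0]

/-- This is Jensen's inequality: `1 + y ≤ exp y` is applied at `y = ω (t - s) - m` for each spin
value `ω`, with the weights tilted by `exp (s ω)`; the linear terms cancel because `m` is the mean
of `ω (t - s)`. -/
theorem cumulant_add_le (β s t : ℝ) :
    cumulant β s + spinMean (spinWeight β) s * (t - s) ≤ cumulant β t := by
  have h0 := spinWeight_pos β
  have h1 := spinWeight_lt_one β
  have hs := spinMgf_pos h0 s
  have ht := spinMgf_pos h0 t
  rw [cumulant_eq_log_cosh, cumulant_eq_log_cosh]
  change Real.log (spinMgf _ s) + _ ≤ Real.log (spinMgf _ t)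
  set p := spinWeight β
  set m := spinMean p s * (t - s) with hm
  rw [← Real.log_exp m, ← Real.log_mul hs.ne' (Real.exp_pos m).ne']
  apply Real.log_le_log (by positivity)
  have a1 := mul_le_mul_of_nonneg_left (Real.add_one_le_exp (-m)) (sub_pos.2 h1).le
  have a2 := mul_le_mul_of_nonneg_left (Real.add_one_le_exp (t - s - m))
    (mul_pos h0 (Real.exp_pos s)).le
  have a3 := mul_le_mul_of_nonneg_left (Real.add_one_le_exp (-(t - s) - m))
    (mul_pos h0 (Real.exp_pos (-s))).le
  have e2 : Real.exp (t - s - m) = Real.exp t * Real.exp (-s) * Real.exp (-m) := by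
    rw [← Real.exp_add, ← Real.exp_add]; ring_nf
  have e3 : Real.exp (-(t - s) - m) = Real.exp (-t) * Real.exp s * Real.exp (-m) := by
    rw [← Real.exp_add, ← Real.exp_add]; ring_nf
  have e4 : Real.exp s * Real.exp (-s) = 1 := by rw [← Real.exp_add]; simp
  have e5 : Real.exp m * Real.exp (-m) = 1 := by rw [← Real.exp_add]; simp
  have hmean : m * spinMgf p s = p * Real.sinh s * (t - s) := by
    rw [hm, spinMean]; field_simp
  have key : spinMgf p s ≤ spinMgf p t * Real.exp (-m) := by
    rw [e2] at a2
    rw [e3] at a3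
    have b2 : p * Real.exp s * (Real.exp t * Real.exp (-s) * Real.exp (-m)) =
        p * Real.exp t * Real.exp (-m) := by linear_combination p * Real.exp t * Real.exp (-m) * e4
    have b3 : p * Real.exp (-s) * (Real.exp (-t) * Real.exp s * Real.exp (-m)) =
        p * Real.exp (-t) * Real.exp (-m) := by
      linear_combination p * Real.exp (-t) * Real.exp (-m) * e4
    rw [b2] at a2
    rw [b3] at a3
    simp only [spinMgf, Real.cosh_eq, Real.sinh_eq] at hmean ⊢
    linarith
  calc spinMgf p s * Real.exp m ≤ spinMgf p t * Real.exp (-m) * Real.exp m :=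
        mul_le_mul_of_nonneg_right key (Real.exp_pos m).le
    _ = spinMgf p t := by rw [mul_assoc, mul_comm (Real.exp (-m)), e5, mul_one]

theorem cumulant_le_abs (β t : ℝ) : cumulant β t ≤ |t| := by
  have h0 := spinWeight_pos β
  rw [cumulant_eq_log_cosh]
  refine (Real.log_le_iff_le_exp (spinMgf_pos h0 t)).2 ?_
  have h1 := spinWeight_lt_one β
  have h2 : Real.cosh t ≤ Real.exp |t| := by
    rw [← Real.cosh_abs, Real.cosh_eq]
    have : Real.exp (-|t|) ≤ Real.exp |t| := Real.exp_le_exp.2 (by linarith [abs_nonneg t])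
    linarith
  have h3 : 1 ≤ Real.exp |t| := Real.one_le_exp (abs_nonneg t)
  unfold spinMgf
  nlinarith

/-- The atoms at `±1` have mass `p / 2` each. The slope is exactly 1, which keeps the Legendre
supremum finite even at `x = ±1`. -/
theorem abs_add_log_le_cumulant (β t : ℝ) :
    |t| + Real.log (spinWeight β / 2) ≤ cumulant β t := by
  have h0 := spinWeight_pos β
  rw [cumulant_eq_log_cosh, ← Real.log_exp |t|,
    ← Real.log_mul (Real.exp_pos _).ne' (by positivity)]
  apply Real.log_le_log (by positivity)
  have h1 := spinWeight_lt_one β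
  have h2 : Real.exp |t| ≤ 2 * Real.cosh t := by
    rw [← Real.cosh_abs, Real.cosh_eq]
    linarith [Real.exp_pos (-|t|)]
  nlinarith

theorem bddAbove_legendre (β : ℝ) {x : ℝ} (hx : x ∈ Set.Icc (-1 : ℝ) 1) :
    BddAbove (Set.range fun t : ℝ => t * x - cumulant β t) := by
  refine ⟨-Real.log (spinWeight β / 2), ?_⟩
  rintro _ ⟨t, rfl⟩
  have h1 := abs_add_log_le_cumulant β t
  have h2 : t * x ≤ |t| := by
    refine (le_abs_self _).trans ?_
    rw [abs_mul]
    exact mul_le_of_le_one_right (abs_nonneg t) (abs_le.2 hx)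
  simp only
  linarith

theorem freeEnergy_le_rate (β K : ℝ) {x : ℝ} (hx : x ∈ Set.Icc (-1 : ℝ) 1) :
    freeEnergy β K x ≤ cramerRate β x - β * K * x ^ 2 := by
  have := le_ciSup (bddAbove_legendre β hx) (2 * β * K * x)
  change _ ≤ cramerRate β x at this
  unfold freeEnergy
  linarith

theorem hasDerivAt_freeEnergy (β K x : ℝ) :
    HasDerivAt (freeEnergy β K)
      (2 * β * K * (x - spinMean (spinWeight β) (2 * β * K * x))) x := by
  have h1 := (hasDerivAt_cumulant β (2 * β * K * x)).comp x
    ((hasDerivAt_id x).const_mul (2 * β * K))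
  have h2 := (((hasDerivAt_id x).pow 2).const_mul (β * K)).sub h1
  refine (h2.congr_deriv ?_).congr_of_eventuallyEq (.of_forall fun y => ?_)
  · simp; ring
  · simp [freeEnergy]

theorem continuous_freeEnergy (β K : ℝ) : Continuous (freeEnergy β K) :=
  continuous_iff_continuousAt.2 fun x => (hasDerivAt_freeEnergy β K x).continuousAt

theorem freeEnergy_zero (β K : ℝ) : freeEnergy β K 0 = 0 := by
  simp [freeEnergy, cumulant_eq_log_cosh]

theorem freeEnergy_neg (β K x : ℝ) : freeEnergy β K (-x) = freeEnergy β K x := by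
  simp [freeEnergy, cumulant_eq_log_cosh]

theorem exists_isMinOn_freeEnergy {β K : ℝ} (hb : 0 < β * K) :
    ∃ x, IsMinOn (freeEnergy β K) Set.univ x := by
  obtain ⟨x, -, hx⟩ := (isCompact_Icc (a := (-2 : ℝ)) (b := 2)).exists_isMinOn
    ⟨0, by norm_num⟩ (continuous_freeEnergy β K).continuousOn
  refine ⟨x, fun y _ => ?_⟩
  by_cases hy : y ∈ Set.Icc (-2 : ℝ) 2
  · exact hx hy
  · have h0 : freeEnergy β K x ≤ 0 := by
      rw [← freeEnergy_zero β K]; exact hx (by norm_num)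
    -- For `|y| > 2` the free energy is at least `b |y| (|y| - 2)`, hence nonnegative, while its
    -- value at 0 is 0.
    have h1 := cumulant_le_abs β (2 * β * K * y)
    have h2 : |2 * β * K * y| = 2 * (β * K) * |y| := by
      rw [abs_mul, mul_assoc 2, abs_mul, abs_of_pos hb, abs_two]
    have h3 : 2 < |y| := by
      by_contra! h
      exact hy (abs_le.1 h)
    have h4 : 0 ≤ freeEnergy β K y := by
      unfold freeEnergy
      rw [← sq_abs]
      nlinarith [mul_pos hb (by linarith : 0 < |y|)]
    exact h0.trans h4

theorem spinMean_eq_of_isMinOn {β K x : ℝ} (hb : 0 < β * K)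
    (hx : IsMinOn (freeEnergy β K) Set.univ x) :
    spinMean (spinWeight β) (2 * β * K * x) = x := by
  have h := (hx.isLocalMin univ_mem).hasDerivAt_eq_zero (hasDerivAt_freeEnergy β K x)
  rcases mul_eq_zero.1 h with h | h <;> linarith

/-- At a fixed point of the mean-field equation, the tangent inequality shows that the Legendre
supremum is attained at `t = 2 β K x`. -/
theorem rate_eq_freeEnergy {β K x : ℝ} (h : spinMean (spinWeight β) (2 * β * K * x) = x) :
    cramerRate β x - β * K * x ^ 2 = freeEnergy β K x := by
  have hx : x ∈ Set.Icc (-1 : ℝ) 1 := by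
    rw [← h]
    exact abs_le.1 (abs_spinMean_lt_one (spinWeight_pos β) (spinWeight_lt_one β) _).le
  refine le_antisymm ?_ (freeEnergy_le_rate β K hx)
  have : cramerRate β x ≤ 2 * β * K * x * x - cumulant β (2 * β * K * x) := by
    refine ciSup_le fun t => ?_
    have := cumulant_add_le β (2 * β * K * x) t
    rw [h] at this
    linarith
  unfold freeEnergy
  linarith

/-- The equilibrium macrostates are the global minimum points of the free-energy functional. -/
theorem equilibria_eq {β K : ℝ} (hb : 0 < β * K) :
    equilibria β K = {x | IsMinOn (freeEnergy β K) Set.univ x} := by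
  have hmem : ∀ {x}, IsMinOn (freeEnergy β K) Set.univ x → x ∈ Set.Icc (-1 : ℝ) 1 := by
    intro x hx
    rw [← spinMean_eq_of_isMinOn hb hx]
    exact abs_le.1 (abs_spinMean_lt_one (spinWeight_pos β) (spinWeight_lt_one β) _).le
  obtain ⟨m, hm⟩ := exists_isMinOn_freeEnergy hb
  -- The free energy lies below `J_β(y) - β K y²`, with equality at its own minimizers, so the two
  -- infima agree.
  have hinf : ⨅ y : Set.Icc (-1 : ℝ) 1, (cramerRate β y - β * K * (y : ℝ) ^ 2) =
      freeEnergy β K m := by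
    have hlow : ∀ y : Set.Icc (-1 : ℝ) 1,
        freeEnergy β K m ≤ cramerRate β y - β * K * (y : ℝ) ^ 2 := fun y =>
      (hm (Set.mem_univ (y : ℝ))).trans (freeEnergy_le_rate β K y.2)
    have : Nonempty (Set.Icc (-1 : ℝ) 1) := ⟨⟨m, hmem hm⟩⟩
    refine le_antisymm ?_ (le_ciInf hlow)
    refine (ciInf_le ⟨freeEnergy β K m, ?_⟩ (⟨m, hmem hm⟩ : Set.Icc (-1 : ℝ) 1)).trans
      (rate_eq_freeEnergy (spinMean_eq_of_isMinOn hb hm)).le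
    rintro _ ⟨y, rfl⟩
    exact hlow y
  ext x
  simp only [equilibria, rateFunction, hinf, Set.mem_ofPred_eq, sub_eq_zero]
  constructor
  · rintro ⟨hx, h⟩ y _
    exact ((freeEnergy_le_rate β K hx).trans h.le).trans (hm (Set.mem_univ y))
  · intro hx
    refine ⟨hmem hx, ?_⟩
    rw [rate_eq_freeEnergy (spinMean_eq_of_isMinOn hb hx)]
    exact le_antisymm (hx (Set.mem_univ m)) (hm (Set.mem_univ x))

/-! ### Unimodality of the free energy -/

theorem sinh_lt_mul_cosh {t : ℝ} (ht : 0 < t) : Real.sinh t < t * Real.cosh t := by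
  have h : StrictMonoOn (fun t => t * Real.cosh t - Real.sinh t) (Set.Ici 0) := by
    refine strictMonoOn_of_deriv_pos (convex_Ici 0) (by fun_prop) fun t ht => ?_
    rw [interior_Ici] at ht
    have hd := ((hasDerivAt_id t).mul (Real.hasDerivAt_cosh t)).sub (Real.hasDerivAt_sinh t)
    have := hd.deriv
    simp only [id] at this
    erw [this]
    have := mul_pos ht (Real.sinh_pos_iff.2 ht)
    linarith
  have := h Set.self_mem_Ici ht.le ht
  simp at this
  linarith

theorem three_mul_cosh_lt {t : ℝ} (ht : 0 < t) :
    3 * (t * Real.cosh t) < (t ^ 2 + 3) * Real.sinh t := by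
  have h : StrictMonoOn (fun t => (t ^ 2 + 3) * Real.sinh t - 3 * (t * Real.cosh t))
      (Set.Ici 0) := by
    refine strictMonoOn_of_deriv_pos (convex_Ici 0) (by fun_prop) fun t ht => ?_
    rw [interior_Ici] at ht
    have hd := ((((hasDerivAt_id t).pow 2).add_const 3).mul (Real.hasDerivAt_sinh t)).sub
      (((hasDerivAt_id t).mul (Real.hasDerivAt_cosh t)).const_mul 3)
    have := hd.deriv
    simp only [id] at this
    erw [this]
    have := mul_pos ht (sub_pos.2 (sinh_lt_mul_cosh ht))
    simp
    linarith
  have := h Set.self_mem_Ici ht.le ht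
  simp at this
  linarith

/-- The derivative is positive when `a (t cosh t - sinh t) < t² sinh t`, which `three_mul_cosh_lt`
gives at `a = 3`. The constant is sharp, since both sides are then `t³` to leading order. -/
theorem strictMonoOn_cosh_sub {a : ℝ} (ha : a ≤ 3) :
    StrictMonoOn (fun t => Real.cosh t - a * (Real.sinh t / t)) (Set.Ioi 0) := by
  have hd : ∀ t : ℝ, 0 < t → HasDerivAt (fun t => Real.cosh t - a * (Real.sinh t / t))
      (Real.sinh t - a * ((Real.cosh t * t - Real.sinh t * 1) / t ^ 2)) t := fun t ht =>
    (Real.hasDerivAt_cosh t).sub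
      (((Real.hasDerivAt_sinh t).div (hasDerivAt_id t) ht.ne').const_mul a)
  refine strictMonoOn_of_deriv_pos (convex_Ioi 0)
    (fun t ht => (hd t ht).continuousAt.continuousWithinAt) fun t ht => ?_
  rw [interior_Ioi] at ht
  have ht' : 0 < t := ht
  rw [(hd t ht).deriv]
  have h1 := three_mul_cosh_lt ht'
  have h2 := sub_pos.2 (sinh_lt_mul_cosh ht')
  have h3 := mul_nonneg (sub_nonneg.2 ha) h2.le
  have e : Real.sinh t - a * ((Real.cosh t * t - Real.sinh t * 1) / t ^ 2) =
      (t ^ 2 * Real.sinh t - a * (t * Real.cosh t - Real.sinh t)) / t ^ 2 := by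
    field_simp
  rw [e]
  apply div_pos _ (by positivity)
  linarith

/-- The sign of the derivative of the free energy on `(0, ∞)` is that of an increasing function. -/
theorem sub_spinMean_eq {p a x : ℝ} (h0 : 0 < p) (ha : 0 < a) (hx : 0 < x) :
    x - spinMean p (a * x) = x / spinMgf p (a * x) *
      (1 - p + p * (Real.cosh (a * x) - a * (Real.sinh (a * x) / (a * x)))) := by
  have := spinMgf_pos h0 (a * x)
  have e : p * Real.cosh (a * x) = spinMgf p (a * x) - 1 + p := by
    rw [spinMgf]
    ring
  rw [spinMean, mul_sub p, e]
  generalize spinMgf p (a * x) = Z at this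
  field_simp
  ring

/-- The increasing factor in `sub_spinMean_eq` vanishes at the critical point `m`, so it is negative
before `m` and positive after it. -/
theorem unimodal_freeEnergy {β K m : ℝ} (hb : 0 < β * K) (h3 : 2 * (β * K) ≤ 3) (hm : 0 < m)
    (hmin : IsMinOn (freeEnergy β K) Set.univ m) :
    StrictAntiOn (freeEnergy β K) (Set.Icc 0 m) ∧ StrictMonoOn (freeEnergy β K) (Set.Ici m) := by
  have h0 := spinWeight_pos β
  have ha : 0 < 2 * β * K := by linarith
  have ha3 : 2 * β * K ≤ 3 := by linarith
  have hmono := strictMonoOn_cosh_sub ha3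
  have hz := spinMean_eq_of_isMinOn hb hmin
  rw [← sub_eq_zero, ← neg_eq_zero, neg_sub, sub_spinMean_eq h0 ha hm] at hz
  have hpos : ∀ {x}, 0 < x → 0 < x / spinMgf (spinWeight β) (2 * β * K * x) := fun hx =>
    div_pos hx (spinMgf_pos h0 _)
  have hz' := (mul_eq_zero.1 hz).resolve_left (hpos hm).ne'
  constructor
  · refine strictAntiOn_of_deriv_neg (convex_Icc 0 m) (continuous_freeEnergy β K).continuousOn
      fun x hx => ?_
    rw [interior_Icc] at hx
    rw [(hasDerivAt_freeEnergy β K x).deriv, sub_spinMean_eq h0 ha hx.1]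
    refine mul_neg_of_pos_of_neg ha (mul_neg_of_pos_of_neg (hpos hx.1) ?_)
    rw [← hz']
    have := hmono (mul_pos ha hx.1) (mul_pos ha hm) (mul_lt_mul_of_pos_left hx.2 ha)
    have := mul_lt_mul_of_pos_left this h0
    simp only at this
    linarith
  · refine strictMonoOn_of_deriv_pos (convex_Ici m) (continuous_freeEnergy β K).continuousOn
      fun x hx => ?_
    rw [interior_Ici] at hx
    have hx0 : 0 < x := hm.trans hx
    rw [(hasDerivAt_freeEnergy β K x).deriv, sub_spinMean_eq h0 ha hx0]
    refine mul_pos ha (mul_pos (hpos hx0) ?_)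
    rw [← hz']
    have := hmono (mul_pos ha hm) (mul_pos ha hx0) (mul_lt_mul_of_pos_left hx ha)
    have := mul_lt_mul_of_pos_left this h0
    simp only at this
    linarith

/-- If the free energy takes negative values, then there are exactly two equilibrium macrostates,
and the free energy is unimodal on `[0, ∞)` with minimum at the magnetization. -/
theorem phase_coexistence {β K : ℝ} (hb : 0 < β * K) (h3 : 2 * (β * K) ≤ 3)
    (hneg : ∃ x, freeEnergy β K x < 0) :
    0 < magnetization β K ∧ equilibria β K = {magnetization β K, -magnetization β K} ∧
      StrictAntiOn (freeEnergy β K) (Set.Icc 0 (magnetization β K)) ∧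
      StrictMonoOn (freeEnergy β K) (Set.Ici (magnetization β K)) := by
  -- A negative value rules out 0 as a minimizer, and evenness allows a positive one to be chosen.
  obtain ⟨m, hm, hmin⟩ : ∃ m, 0 < m ∧ IsMinOn (freeEnergy β K) Set.univ m := by
    obtain ⟨x, hx⟩ := exists_isMinOn_freeEnergy hb
    have hx0 : x ≠ 0 := by
      rintro rfl
      obtain ⟨y, hy⟩ := hneg
      have := hx (Set.mem_univ y)
      simp only [Set.mem_ofPred_eq, freeEnergy_zero] at this
      linarith
    rcases hx0.lt_or_gt with h | h
    · refine ⟨-x, by linarith, fun y hy => ?_⟩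
      simpa only [Set.mem_ofPred_eq, freeEnergy_neg] using hx hy
    · exact ⟨x, h, hx⟩
  obtain ⟨hanti, hmono⟩ := unimodal_freeEnergy hb h3 hm hmin
  have hstrict : ∀ x, 0 ≤ x → x ≠ m → freeEnergy β K m < freeEnergy β K x := by
    intro x hx hne
    rcases hne.lt_or_gt with h | h
    · exact hanti ⟨hx, h.le⟩ ⟨hm.le, le_rfl⟩ h
    · exact hmono Set.self_mem_Ici h.le h
  have heq : equilibria β K = {m, -m} := by
    rw [equilibria_eq hb]
    ext x
    simp only [Set.mem_ofPred_eq, Set.mem_insert_iff, Set.mem_singleton_iff]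
    constructor
    · intro hx
      have h1 : freeEnergy β K |x| = freeEnergy β K x := by
        rcases abs_choice x with h | h <;> simp [h, freeEnergy_neg]
      by_contra! hne
      have h2 := hstrict |x| (abs_nonneg x) fun h => by
        rcases (abs_eq hm.le).1 h with h | h
        exacts [hne.1 h, hne.2 h]
      have h4 : freeEnergy β K x ≤ freeEnergy β K m := hx (Set.mem_univ m)
      linarith
    · rintro (rfl | rfl)
      · exact hmin
      · intro y hy
        simpa only [Set.mem_ofPred_eq, freeEnergy_neg] using hmin hy
  have hmag : magnetization β K = m := by
    rw [magnetization, heq, csSup_pair]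
    exact max_eq_left (by linarith)
  rw [hmag]
  exact ⟨hm, heq, hanti, hmono⟩

/-! ### Scaling limit along the sequence -/

theorem tendsto_one_div_rpow {α : ℝ} (hα : 0 < α) :
    Tendsto (fun n : ℕ => 1 / (n : ℝ) ^ α) atTop (𝓝[>] 0) := by
  simp only [one_div]
  exact tendsto_inv_atTop_nhdsGT_zero.comp
    ((tendsto_rpow_atTop hα).comp tendsto_natCast_atTop_atTop)

theorem kSeq_eq (α ℓ : ℝ) (n : ℕ) : kSeq α ℓ n = kPath ℓ (1 / (n : ℝ) ^ α) := by
  have : (n : ℝ) ^ (2 * α) = ((n : ℝ) ^ α) ^ 2 := by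
    rw [mul_comm, Real.rpow_mul n.cast_nonneg, Real.rpow_two]
  rw [kSeq, kPath, this, ← div_eq_mul_one_div, one_div_pow, div_mul_div_comm, mul_one]

theorem sqrt_one_div_rpow (α : ℝ) (n : ℕ) : √(1 / (n : ℝ) ^ α) = 1 / (n : ℝ) ^ (α / 2) := by
  rw [Real.sqrt_div zero_le_one, Real.sqrt_one, Real.sqrt_eq_rpow,
    ← Real.rpow_mul n.cast_nonneg, mul_one_div]

theorem tendsto_betaSeq {α : ℝ} (hα : 0 < α) : Tendsto (betaSeq α) atTop (𝓝 betaC) := by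
  have h := ((tendsto_one_div_rpow hα).mono_right nhdsWithin_le_nhds).const_sub betaC
  rwa [sub_zero] at h

theorem tendsto_kSeq {α : ℝ} (ℓ : ℝ) (hα : 0 < α) :
    Tendsto (kSeq α ℓ) atTop (𝓝 (critCurve betaC)) := by
  have h : Tendsto (kPath ℓ) (𝓝[>] 0) (𝓝 (kPath ℓ 0)) :=
    tendsto_nhdsGT_of_continuousAt (by unfold kPath; fun_prop)
  have h1 := h.comp (tendsto_one_div_rpow hα)
  simp only [kPath, mul_zero, sub_zero, ne_eq, OfNat.ofNat_ne_zero, not_false_eq_true, zero_pow,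
    add_zero] at h1
  exact h1.congr fun n => (kSeq_eq α ℓ n).symm

theorem glPoly_eq (ℓ x : ℝ) :
    glPoly ℓ x = 3 / 2 * (betaC / 3 * (iteratedDeriv 2 critCurve betaC - ℓ)) * x ^ 2
      + 3 / 4 * x ^ 4 + 9 / 40 * x ^ 6 := by
  rw [glPoly]
  ring

/-- The rescaled point moves together with `h`; this joint limit is what gives local uniformity. -/
theorem tendsto_scaled_freeEnergy_path (ℓ x : ℝ) :
    Tendsto (fun q : ℝ × ℝ => freeEnergy (betaC - q.1) (kPath ℓ q.1) (q.2 * √q.1) / q.1 ^ 3)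
      (𝓝[>] 0 ×ˢ 𝓝 x) (𝓝 (glPoly ℓ x)) := by
  have hf : Tendsto (fun q : ℝ × ℝ => q.1) (𝓝[>] 0 ×ˢ 𝓝 x) (𝓝[>] 0) := tendsto_fst
  have := tendsto_scaled_freeEnergy_aux (h := fun q : ℝ × ℝ => q.1) (s := fun q => q.2) (x := x)
    (hf.mono_right nhdsWithin_le_nhds) (hf.eventually self_mem_nhdsWithin) tendsto_snd
    ((tendsto_beta_mul_kPath ℓ).comp hf) (tendsto_spinWeight.comp hf)
    ((tendsto_quadratic_coeff ℓ).comp hf) (tendsto_quartic_coeff.comp hf)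
  rw [glPoly_eq]
  refine this.congr fun q => ?_
  rw [freeEnergy, cumulant_eq_log_cosh]
  simp only [Function.comp, ← mul_assoc]

theorem scaled_freeEnergy_eq (α ℓ x : ℝ) (n : ℕ) :
    (n : ℝ) ^ (1 - (1 - 3 * α)) * freeEnergy (betaSeq α n) (kSeq α ℓ n) (x / (n : ℝ) ^ (α / 2)) =
      freeEnergy (betaC - 1 / (n : ℝ) ^ α) (kPath ℓ (1 / (n : ℝ) ^ α))
        (x * √(1 / (n : ℝ) ^ α)) / (1 / (n : ℝ) ^ α) ^ 3 := by
  have : (n : ℝ) ^ (1 - (1 - 3 * α)) = ((n : ℝ) ^ α) ^ 3 := by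
    rw [← Real.rpow_mul_natCast n.cast_nonneg]
    congr 1
    push_cast
    ring
  rw [sqrt_one_div_rpow, ← kSeq_eq, this, mul_one_div, betaSeq, one_div_pow, div_div_eq_mul_div,
    div_one, mul_comm]

theorem continuous_glPoly (ℓ : ℝ) : Continuous (glPoly ℓ) := by
  unfold glPoly
  fun_prop

theorem tendstoLocallyUniformly_scaled_freeEnergy {α : ℝ} (ℓ : ℝ) (hα : 0 < α) :
    TendstoLocallyUniformly (fun (n : ℕ) (x : ℝ) => (n : ℝ) ^ (1 - (1 - 3 * α)) *
      freeEnergy (betaSeq α n) (kSeq α ℓ n) (x / (n : ℝ) ^ (α / 2))) (glPoly ℓ) atTop := by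
  rw [tendstoLocallyUniformly_iff_forall_tendsto]
  intro x
  have h1 : Tendsto (fun y : ℕ × ℝ => (1 / (y.1 : ℝ) ^ α, y.2)) (atTop ×ˢ 𝓝 x)
      (𝓝[>] 0 ×ˢ 𝓝 x) := (tendsto_one_div_rpow hα).prodMap tendsto_id
  have h2 := (tendsto_scaled_freeEnergy_path ℓ x).comp h1
  have h3 : Tendsto (fun y : ℕ × ℝ => glPoly ℓ y.2) (atTop ×ˢ 𝓝 x) (𝓝 (glPoly ℓ x)) :=
    ((continuous_glPoly ℓ).tendsto x).comp tendsto_snd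
  have h4 := (h3.prodMk_nhds h2).mono_right (nhds_le_uniformity (glPoly ℓ x))
  refine h4.congr fun y => ?_
  simp only [Function.comp, scaled_freeEnergy_eq]

/-! ### Minimizers of the Ginzburg-Landau polynomial -/

section Polynomial

variable {ℓ : ℝ}

/-- The equation is `g'(x) / x = 0`, a quadratic in `x²` whose positive root is `10/9 * (-1 + s)`.
-/
theorem xBar_sq (hℓ : iteratedDeriv 2 critCurve betaC < ℓ) :
    0 < xBar ℓ ∧ betaC * (iteratedDeriv 2 critCurve betaC - ℓ) + 3 * xBar ℓ ^ 2
      + 27 / 20 * xBar ℓ ^ 4 = 0 := by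
  have hD := mul_pos betaC_pos (sub_pos.2 hℓ)
  rw [xBar]
  set E := betaC * (ℓ - iteratedDeriv 2 critCurve betaC) with hE
  have e1 : 3 * betaC / 5 * (ℓ - iteratedDeriv 2 critCurve betaC) = 3 / 5 * E := by rw [hE]; ring
  rw [e1]
  set s := √(1 + 3 / 5 * E) with hs
  have hs1 : 1 < s := by
    rw [hs, Real.lt_sqrt zero_le_one]
    linarith
  have hs2 : s ^ 2 = 1 + 3 / 5 * E := Real.sq_sqrt (by linarith)
  constructor
  · exact mul_pos (by positivity) (Real.sqrt_pos.2 (by linarith))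
  · have h2 : (√10 / 3 * √(-1 + s)) ^ 2 = 10 / 9 * (-1 + s) := by
      rw [mul_pow, div_pow, Real.sq_sqrt (by norm_num), Real.sq_sqrt (by linarith)]
      norm_num
    have h4 : (√10 / 3 * √(-1 + s)) ^ 4 = (10 / 9 * (-1 + s)) ^ 2 := by rw [← h2]; ring
    have h5 : betaC * (iteratedDeriv 2 critCurve betaC - ℓ) = -E := by rw [hE]; ring
    rw [h2, h4, h5]
    linear_combination (5 / 3) * hs2

/-- As a polynomial in `x²`, the difference has a double root at the critical value; the cofactor is
positive, so the minimizers can be read off. -/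
theorem glPoly_sub_xBar (hℓ : iteratedDeriv 2 critCurve betaC < ℓ) (x : ℝ) :
    glPoly ℓ x - glPoly ℓ (xBar ℓ) =
      (x ^ 2 - xBar ℓ ^ 2) ^ 2 * (3 / 4 + 9 / 20 * xBar ℓ ^ 2 + 9 / 40 * x ^ 2) := by
  have h := (xBar_sq hℓ).2
  rw [glPoly, glPoly]
  linear_combination (1 / 2) * (x ^ 2 - xBar ℓ ^ 2) * h

theorem glPoly_xBar_lt (hℓ : iteratedDeriv 2 critCurve betaC < ℓ) {x : ℝ}
    (h1 : x ≠ xBar ℓ) (h2 : x ≠ -xBar ℓ) : glPoly ℓ (xBar ℓ) < glPoly ℓ x := by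
  rw [← sub_pos, glPoly_sub_xBar hℓ]
  have : x ^ 2 - xBar ℓ ^ 2 ≠ 0 := fun h => by
    rcases sq_eq_sq_iff_eq_or_eq_neg.1 (sub_eq_zero.1 h) with h | h
    exacts [h1 h, h2 h]
  positivity

theorem glPoly_zero : glPoly ℓ 0 = 0 := by simp [glPoly]

theorem glPoly_xBar_neg (hℓ : iteratedDeriv 2 critCurve betaC < ℓ) : glPoly ℓ (xBar ℓ) < 0 := by
  have h := (xBar_sq hℓ).1
  have := glPoly_xBar_lt hℓ (x := 0) h.ne (by linarith)
  rwa [glPoly_zero] at this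

theorem setOf_isMinOn_glPoly (hℓ : iteratedDeriv 2 critCurve betaC < ℓ) :
    {x : ℝ | IsMinOn (glPoly ℓ) Set.univ x} = {xBar ℓ, -xBar ℓ} := by
  have hmin : IsMinOn (glPoly ℓ) Set.univ (xBar ℓ) := fun x _ => by
    change glPoly ℓ (xBar ℓ) ≤ glPoly ℓ x
    rw [← sub_nonneg, glPoly_sub_xBar hℓ]
    positivity
  ext x
  simp only [Set.mem_ofPred_eq, Set.mem_insert_iff, Set.mem_singleton_iff]
  constructor
  · intro hx
    by_contra! h
    exact absurd (hx (Set.mem_univ (xBar ℓ))) (not_le.2 (glPoly_xBar_lt hℓ h.1 h.2))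
  · rintro (rfl | rfl)
    · exact hmin
    · have : glPoly ℓ (-xBar ℓ) = glPoly ℓ (xBar ℓ) := by simp only [glPoly]; ring
      intro y hy
      simpa only [Set.mem_ofPred_eq, this] using hmin hy

theorem exists_ne_zero_isMinOn_glPoly_iff :
    (∃ x : ℝ, x ≠ 0 ∧ IsMinOn (glPoly ℓ) Set.univ x) ↔ iteratedDeriv 2 critCurve betaC < ℓ := by
  constructor
  · rintro ⟨x, hx, hmin⟩
    by_contra! h
    have h1 : glPoly ℓ x ≤ glPoly ℓ 0 := hmin (Set.mem_univ 0)
    rw [glPoly_zero, glPoly] at h1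
    have := mul_nonneg (mul_nonneg betaC_pos.le (sub_nonneg.2 h)) (sq_nonneg x)
    have : 0 < x ^ 4 := by positivity
    have : 0 < x ^ 6 := by positivity
    linarith
  · intro h
    refine ⟨xBar ℓ, (xBar_sq h).1.ne', ?_⟩
    have : xBar ℓ ∈ {x : ℝ | IsMinOn (glPoly ℓ) Set.univ x} := by
      rw [setOf_isMinOn_glPoly h]; exact Set.mem_insert _ _
    exact this

end Polynomial

/-! ### Asymptotics of the magnetization -/

theorem tendsto_scaled_freeEnergy {α : ℝ} (ℓ : ℝ) (hα : 0 < α) (x : ℝ) :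
    Tendsto (fun n : ℕ => (n : ℝ) ^ (1 - (1 - 3 * α)) *
      freeEnergy (betaSeq α n) (kSeq α ℓ n) (x / (n : ℝ) ^ (α / 2))) atTop (𝓝 (glPoly ℓ x)) :=
  (tendstoLocallyUniformly_iff_forall_isCompact.1
    (tendstoLocallyUniformly_scaled_freeEnergy ℓ hα) {x} isCompact_singleton).tendsto_at rfl

theorem eventually_phase_coexistence {α ℓ : ℝ} (hα : 0 < α)
    (hℓ : iteratedDeriv 2 critCurve betaC < ℓ) :
    ∀ᶠ n : ℕ in atTop, 0 < magnetization (betaSeq α n) (kSeq α ℓ n) ∧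
      equilibria (betaSeq α n) (kSeq α ℓ n) = {magnetization (betaSeq α n) (kSeq α ℓ n),
        -magnetization (betaSeq α n) (kSeq α ℓ n)} ∧
      StrictAntiOn (freeEnergy (betaSeq α n) (kSeq α ℓ n))
        (Set.Icc 0 (magnetization (betaSeq α n) (kSeq α ℓ n))) ∧
      StrictMonoOn (freeEnergy (betaSeq α n) (kSeq α ℓ n))
        (Set.Ici (magnetization (betaSeq α n) (kSeq α ℓ n))) := by
  have h1 := (tendsto_one_div_rpow hα).eventually (eventually_beta_mul_kPath_lt ℓ)
  have h2 := (tendsto_one_div_rpow hα).eventually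
    ((tendsto_beta_mul_kPath ℓ).eventually_const_lt (by norm_num : (0 : ℝ) < 3 / 2))
  have h3 := (tendsto_scaled_freeEnergy ℓ hα (xBar ℓ)).eventually_lt_const (glPoly_xBar_neg hℓ)
  filter_upwards [h1, h2, h3] with n h1 h2 h3
  rw [← kSeq_eq] at h1 h2
  exact phase_coexistence h2 h1.le ⟨_, neg_of_mul_neg_right h3 (Real.rpow_nonneg n.cast_nonneg _)⟩

/-- If the scaled magnetization were on the far side of some `y ≠ xBar ℓ`, unimodality would make
the free energy smaller at scaled `y` than at scaled `xBar ℓ`, against the strict inequality in the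
limit. -/
theorem tendsto_scaled_magnetization {α ℓ : ℝ} (hα : 0 < α)
    (hℓ : iteratedDeriv 2 critCurve betaC < ℓ) :
    Tendsto (fun n : ℕ => (n : ℝ) ^ (α / 2) * magnetization (betaSeq α n) (kSeq α ℓ n)) atTop
      (𝓝 (xBar ℓ)) := by
  have hx := (xBar_sq hℓ).1
  have hcmp : ∀ y, 0 ≤ y → y ≠ xBar ℓ → ∀ᶠ n : ℕ in atTop,
      freeEnergy (betaSeq α n) (kSeq α ℓ n) (xBar ℓ / (n : ℝ) ^ (α / 2)) <
        freeEnergy (betaSeq α n) (kSeq α ℓ n) (y / (n : ℝ) ^ (α / 2)) := by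
    intro y hy hne
    have := (tendsto_scaled_freeEnergy ℓ hα (xBar ℓ)).eventually_lt
      (tendsto_scaled_freeEnergy ℓ hα y) (glPoly_xBar_lt hℓ hne (by linarith))
    filter_upwards [this] with n hn
    exact lt_of_mul_lt_mul_left hn (Real.rpow_nonneg n.cast_nonneg _)
  have hev := eventually_phase_coexistence hα hℓ
  rw [tendsto_order]
  constructor
  · intro y hy
    -- The comparison point must be nonnegative, to stay away from the other minimizer `-xBar ℓ`.
    have hy0 : 0 ≤ max y 0 := le_max_right _ _
    have hy1 : max y 0 < xBar ℓ := max_lt hy hx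
    filter_upwards [hev, hcmp _ hy0 hy1.ne, eventually_gt_atTop 0] with n h1 h2 hn
    have hp : 0 < (n : ℝ) ^ (α / 2) := by positivity
    by_contra! h
    have h4 : magnetization (betaSeq α n) (kSeq α ℓ n) ≤ max y 0 / (n : ℝ) ^ (α / 2) := by
      rw [le_div_iff₀ hp, mul_comm]
      exact h.trans (le_max_left _ _)
    have h5 : max y 0 / (n : ℝ) ^ (α / 2) < xBar ℓ / (n : ℝ) ^ (α / 2) :=
      div_lt_div_of_pos_right hy1 hp
    exact (h2.trans (h1.2.2.2 h4 (h4.trans h5.le) h5)).false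
  · intro y hy
    filter_upwards [hev, hcmp _ (hx.trans hy).le hy.ne', eventually_gt_atTop 0] with n h1 h2 hn
    have hp : 0 < (n : ℝ) ^ (α / 2) := by positivity
    by_contra! h
    have h4 : y / (n : ℝ) ^ (α / 2) ≤ magnetization (betaSeq α n) (kSeq α ℓ n) := by
      rw [div_le_iff₀ hp, mul_comm]
      exact h
    have h5 : xBar ℓ / (n : ℝ) ^ (α / 2) < y / (n : ℝ) ^ (α / 2) :=
      div_lt_div_of_pos_right hy hp
    exact (h2.trans (h1.2.2.1 ⟨by positivity, h5.le.trans h4⟩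
      ⟨div_nonneg (hx.trans hy).le hp.le, h4⟩ h5)).false

theorem magnetization_isEquivalent {α ℓ : ℝ} (hα : 0 < α)
    (hℓ : iteratedDeriv 2 critCurve betaC < ℓ) :
    (fun n : ℕ => magnetization (betaSeq α n) (kSeq α ℓ n))
      ~[atTop] (fun n : ℕ => xBar ℓ / (n : ℝ) ^ (α / 2)) := by
  have hx := (xBar_sq hℓ).1
  refine isEquivalent_of_tendsto_one ?_
  have h := (tendsto_scaled_magnetization hα hℓ).div_const (xBar ℓ)
  rw [div_self hx.ne'] at h
  refine h.congr fun n => ?_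
  simp only [Pi.div_apply]
  rw [div_div_eq_mul_div, mul_comm]

theorem tendsto_magnetization {α ℓ : ℝ} (hα : 0 < α)
    (hℓ : iteratedDeriv 2 critCurve betaC < ℓ) :
    Tendsto (fun n : ℕ => magnetization (betaSeq α n) (kSeq α ℓ n)) atTop (𝓝 0) := by
  refine (magnetization_isEquivalent hα hℓ).symm.tendsto_nhds ?_
  have h := ((tendsto_one_div_rpow (half_pos hα)).mono_right nhdsWithin_le_nhds).const_mul (xBar ℓ)
  simpa [div_eq_mul_inv] using h

theorem betaC_sub_betaSeq_rpow (α : ℝ) (n : ℕ) :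
    (betaC - betaSeq α n) ^ (1 / 2 : ℝ) = 1 / (n : ℝ) ^ (α / 2) := by
  rw [betaSeq, sub_sub_cancel, ← Real.sqrt_eq_rpow, sqrt_one_div_rpow]

end BlumeCapel

theorem theorem5p3 (α ℓ : ℝ) (hα : 0 < α) :
    -- the sequence converges to the tricritical point
    Tendsto (fun n : ℕ => (BlumeCapel.betaSeq α n, BlumeCapel.kSeq α ℓ n)) atTop
      (𝓝 (BlumeCapel.betaC, BlumeCapel.critCurve BlumeCapel.betaC)) ∧
    -- (a) convergence of the scaled free-energy functionals, uniformly on compact sets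
    (∀ u γ : ℝ, u = 1 - 3 * α → γ = α / 2 → ∀ C : Set ℝ, IsCompact C →
      TendstoUniformlyOn
        (fun (n : ℕ) (x : ℝ) => (n : ℝ) ^ (1 - u) *
          BlumeCapel.freeEnergy (BlumeCapel.betaSeq α n) (BlumeCapel.kSeq α ℓ n)
            (x / (n : ℝ) ^ γ))
        (BlumeCapel.glPoly ℓ) atTop C) ∧
    -- (b) global minimum points of the Ginzburg-Landau polynomial
    ((∃ x : ℝ, x ≠ 0 ∧ IsMinOn (BlumeCapel.glPoly ℓ) Set.univ x) ↔
      iteratedDeriv 2 BlumeCapel.critCurve BlumeCapel.betaC < ℓ) ∧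
    (iteratedDeriv 2 BlumeCapel.critCurve BlumeCapel.betaC < ℓ →
      {x : ℝ | IsMinOn (BlumeCapel.glPoly ℓ) Set.univ x} =
        {BlumeCapel.xBar ℓ, -BlumeCapel.xBar ℓ}) ∧
    -- (c) phase coexistence for large n, and asymptotics of the magnetization
    (iteratedDeriv 2 BlumeCapel.critCurve BlumeCapel.betaC < ℓ →
      (∀ᶠ n : ℕ in atTop,
        0 < BlumeCapel.magnetization (BlumeCapel.betaSeq α n) (BlumeCapel.kSeq α ℓ n) ∧
        BlumeCapel.equilibria (BlumeCapel.betaSeq α n) (BlumeCapel.kSeq α ℓ n) =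
          {BlumeCapel.magnetization (BlumeCapel.betaSeq α n) (BlumeCapel.kSeq α ℓ n),
            -BlumeCapel.magnetization (BlumeCapel.betaSeq α n) (BlumeCapel.kSeq α ℓ n)}) ∧
      Tendsto (fun n : ℕ =>
        BlumeCapel.magnetization (BlumeCapel.betaSeq α n) (BlumeCapel.kSeq α ℓ n))
        atTop (𝓝 0) ∧
      Tendsto (fun n : ℕ => (n : ℝ) ^ (α / 2) *
        BlumeCapel.magnetization (BlumeCapel.betaSeq α n) (BlumeCapel.kSeq α ℓ n))
        atTop (𝓝 (BlumeCapel.xBar ℓ)) ∧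
      (fun n : ℕ =>
        BlumeCapel.magnetization (BlumeCapel.betaSeq α n) (BlumeCapel.kSeq α ℓ n))
        ~[atTop] (fun n : ℕ => BlumeCapel.xBar ℓ / (n : ℝ) ^ (α / 2)) ∧
      (fun n : ℕ =>
        BlumeCapel.magnetization (BlumeCapel.betaSeq α n) (BlumeCapel.kSeq α ℓ n))
        ~[atTop] (fun n : ℕ => BlumeCapel.xBar ℓ *
          (BlumeCapel.betaC - BlumeCapel.betaSeq α n) ^ (1 / 2 : ℝ))) := by
  open BlumeCapel in
  refine ⟨(tendsto_betaSeq hα).prodMk_nhds (tendsto_kSeq ℓ hα), ?_,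
    exists_ne_zero_isMinOn_glPoly_iff, setOf_isMinOn_glPoly, fun hℓ => ⟨?_,
      tendsto_magnetization hα hℓ, tendsto_scaled_magnetization hα hℓ,
      magnetization_isEquivalent hα hℓ, ?_⟩⟩
  · rintro u γ rfl rfl C hC
    exact tendstoLocallyUniformly_iff_forall_isCompact.1
      (tendstoLocallyUniformly_scaled_freeEnergy ℓ hα) C hC
  · exact (eventually_phase_coexistence hα hℓ).mono fun n h => ⟨h.1, h.2.1⟩
  · simp only [betaC_sub_betaSeq_rpow, mul_one_div]
    exact magnetization_isEquivalent hα hℓ
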